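/- Let $F$ be a free semigroup (without adjoined identity) on a set of at least two free generators (possibly infinite), and let $I$ be a proper two-sided ideal of $F$, that is, $\emptyset\ne I\ne F$, $FI\subseteq I$ and $IF\subseteq I$. Then the semigroup $I$ has cohomological dimension greater than $1$. Here, for a semigroup $S$ and a left $S$-module $A$ (an abelian group with an action of $S$ by additive endomorphisms satisfying $x(ya)=(xy)a$), $H^n(S,A)$ is the $n$-th Eilenberg--MacLane cohomology group, i.e. the $n$-th cohomology group of the complex of all maps $f:S^n\to A$ ($n\ge 0$) with coboundary $$\partial^n f(x_1,\ldots,x_{n+1})=x_1f(x_2,\ldots,x_{n+1})+\sum_{i=1}^n(-1)^if(x_1,\ldots,x_ix_{i+1},\ldots,x_{n+1})+(-1)^{n+1}f(x_1,\ldots,x_n),$$ and the cohomological dimension of $S$ is the largest integer $n$ such that $H^n(S,A)\neq 0$ for some $S$-module $A$ (and $\infty$ if there are arbitrarily large such $n$). -/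

import Mathlib

/-!
A function `φ` on a semigroup `S` with `φ (s * t) = φ s` yields the 2-cocycle `(s, t) ↦ φ t • s`
with values in `ℤS`. Suppose it is the coboundary of `h`, and let `u`, `v` satisfy `vS ⊆ uS`,
`v ∉ uS ∪ {u}` and `v ∉ vS`. Comparing the coefficients of `v` in the coboundary equation at
`(u, y)` and `(v, t)`, where `u * y = v * t`, gives `φ t = h(v)(v) - h(u)(v)`, so `φ` is constant.

In a proper ideal `I` of a free semigroup, take `u = s ∈ I` and `v = s * a` with `a ∉ I`; the
function `φ` telling whether a word starts with a given letter is not constant on `I`.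
-/

universe u

namespace EMCohomology

section Complex

variable {S : Type*} [Semigroup S] {A : Type*} [AddCommGroup A]

/-- The coboundary homomorphism `∂ⁿ : Cⁿ(S, A) → Cⁿ⁺¹(S, A)`, where `Cⁿ(S, A)` is the group of all
maps `Sⁿ → A` and `A` is a left `S`-module with action `ρ`
(a semigroup homomorphism from `S` to the additive endomorphisms of `A`).
The tuple `Fin.contractNth i.castSucc (· * ·) x` multiplies the adjacent entries
`x i` and `x (i + 1)` (entries counted from `0`). -/
def d (ρ : S →ₙ* AddMonoid.End A) (n : ℕ) :
    ((Fin n → S) → A) →+ ((Fin (n + 1) → S) → A) where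
  toFun f x :=
    ρ (x 0) (f fun i => x i.succ)
      + ∑ i : Fin n, (-1 : ℤ) ^ ((i : ℕ) + 1) • f (Fin.contractNth i.castSucc (· * ·) x)
      + (-1 : ℤ) ^ (n + 1) • f fun i => x i.castSucc
  map_zero' := by
    funext x
    simp
  map_add' f g := by
    funext x
    simp only [Pi.add_apply, map_add, smul_add, Finset.sum_add_distrib]
    abel

/-- The group `Zⁿ(S, A)` of cocycles. -/
def cocycles (ρ : S →ₙ* AddMonoid.End A) (n : ℕ) : AddSubgroup ((Fin n → S) → A) :=
  (d ρ n).ker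

/-- The group `Bⁿ(S, A)` of coboundaries (zero in degree `0`). -/
def coboundaries (ρ : S →ₙ* AddMonoid.End A) : (n : ℕ) → AddSubgroup ((Fin n → S) → A)
  | 0 => ⊥
  | n + 1 => (d ρ n).range

/-- The Eilenberg–MacLane cohomology group `Hⁿ(S, A) = Zⁿ(S, A) / Bⁿ(S, A)`. -/
abbrev H (ρ : S →ₙ* AddMonoid.End A) (n : ℕ) : Type _ :=
  cocycles ρ n ⧸ (coboundaries ρ n).addSubgroupOf (cocycles ρ n)

end Complex

/-- The cohomological dimension of a semigroup `S`: the largest `n` such that `Hⁿ(S, A) ≠ 0` for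
some `S`-module `A`, and `⊤` if there are arbitrarily large such `n`. -/
noncomputable def cohomologicalDimension (S : Type u) [Semigroup S] : ℕ∞ :=
  sSup {m : ℕ∞ | ∃ n : ℕ, m = n ∧
    ∃ (A : Type u) (_ : AddCommGroup A) (ρ : S →ₙ* AddMonoid.End A), Nontrivial (H ρ n)}

end EMCohomology

/-- A subsemigroup `I` of `S` is a two-sided ideal if it is nonempty and `SI ⊆ I`, `IS ⊆ I`.
(Every two-sided ideal of a semigroup is a subsemigroup.) -/
structure IsTwoSidedSemigroupIdeal {S : Type*} [Semigroup S] (I : Subsemigroup S) : Prop where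
  nonempty : (I : Set S).Nonempty
  mul_mem_left : ∀ s : S, ∀ x ∈ I, s * x ∈ I
  mul_mem_right : ∀ s : S, ∀ x ∈ I, x * s ∈ I

namespace EMCohomology

section LowDegree

variable {S : Type*} [Semigroup S] {A : Type*} [AddCommGroup A] {ρ : S →ₙ* AddMonoid.End A}

theorem d_one_apply (h : (Fin 1 → S) → A) (x : Fin 2 → S) :
    d ρ 1 h x = ρ (x 0) (h ![x 1]) - h ![x 0 * x 1] + h ![x 0] := by
  have tail : (fun i : Fin 1 => x i.succ) = ![x 1] := by
    ext i; fin_cases i; rfl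
  have contract : Fin.contractNth (0 : Fin 1).castSucc (· * ·) x = ![x 0 * x 1] := by
    ext i; fin_cases i; rfl
  have init : (fun i : Fin 1 => x i.castSucc) = ![x 0] := by
    ext i; fin_cases i; rfl
  simp only [d, AddMonoidHom.coe_mk, ZeroHom.coe_mk, Fin.sum_univ_one, tail, contract, init]
  simp [sub_eq_add_neg]

theorem d_two_apply (f : (Fin 2 → S) → A) (x : Fin 3 → S) :
    d ρ 2 f x =
      ρ (x 0) (f ![x 1, x 2]) - f ![x 0 * x 1, x 2] + f ![x 0, x 1 * x 2] - f ![x 0, x 1] := by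
  have tail : (fun i : Fin 2 => x i.succ) = ![x 1, x 2] := by
    ext i; fin_cases i <;> rfl
  have contract_zero : Fin.contractNth (0 : Fin 2).castSucc (· * ·) x = ![x 0 * x 1, x 2] := by
    ext i; fin_cases i <;> rfl
  have contract_one : Fin.contractNth (1 : Fin 2).castSucc (· * ·) x = ![x 0, x 1 * x 2] := by
    ext i; fin_cases i <;> rfl
  have init : (fun i : Fin 2 => x i.castSucc) = ![x 0, x 1] := by
    ext i; fin_cases i <;> rfl
  simp only [d, AddMonoidHom.coe_mk, ZeroHom.coe_mk, Fin.sum_univ_two, tail, contract_zero,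
    contract_one, init]
  simp [sub_eq_add_neg, add_assoc]

theorem nontrivial_H_succ {n : ℕ} {f : (Fin (n + 1) → S) → A} (hf : d ρ (n + 1) f = 0)
    (hf' : ∀ h, d ρ n h ≠ f) : Nontrivial (H ρ (n + 1)) := by
  rw [QuotientAddGroup.nontrivial_iff, Ne, AddSubgroup.addSubgroupOf_eq_top]
  intro hle
  obtain ⟨h, hh⟩ := hle (show f ∈ cocycles ρ (n + 1) from hf)
  exact hf' h hh

end LowDegree

theorem le_cohomologicalDimension {S A : Type u} [Semigroup S] [AddCommGroup A]
    {ρ : S →ₙ* AddMonoid.End A} {n : ℕ} (hn : Nontrivial (H ρ n)) :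
    (n : ℕ∞) ≤ cohomologicalDimension S :=
  le_sSup ⟨n, rfl, A, inferInstance, ρ, hn⟩

section WeightCochain

variable {S : Type*} [Semigroup S] {M : Type*} [AddCommGroup M]

variable (S M) in
/-- The left `S`-module `M[S]` of finitely supported functions `S → M`, with `S` acting by left
translation of the basis; for `M = ℤ` it is the left regular module `ℤS`. -/
noncomputable def leftRegular : S →ₙ* AddMonoid.End (S →₀ M) where
  toFun s := (Finsupp.mapDomain.addMonoidHom (s * ·) : (S →₀ M) →+ (S →₀ M))
  map_mul' s t := by
    refine Finsupp.addHom_ext fun x m => ?_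
    change Finsupp.mapDomain _ _ = Finsupp.mapDomain _ (Finsupp.mapDomain _ _)
    simp only [Finsupp.mapDomain_single, mul_assoc]

theorem leftRegular_apply (s : S) (f : S →₀ M) :
    leftRegular S M s f = Finsupp.mapDomain (s * ·) f := rfl

/-- The 2-cochain `(s, t) ↦ φ t • s` with values in `M[S]`, which detects whether a function `φ`
invariant under right multiplication is constant. -/
noncomputable def weightCochain (φ : S → M) : (Fin 2 → S) → (S →₀ M) :=
  fun x => Finsupp.single (x 0) (φ (x 1))

theorem d_weightCochain {φ : S → M} (hφ : ∀ s t, φ (s * t) = φ s) :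
    d (leftRegular S M) 2 (weightCochain φ) = 0 := by
  funext x
  simp [d_two_apply, leftRegular_apply, weightCochain, Finsupp.mapDomain_single, hφ]

theorem apply_mul_of_d_one_eq_weightCochain {φ : S → M} {h : (Fin 1 → S) → (S →₀ M)}
    (hh : d (leftRegular S M) 1 h = weightCochain φ) {s v : S} (hv : ∀ x, s * x ≠ v) (t : S) :
    h ![s * t] v = h ![s] v - Finsupp.single s (φ t) v := by
  have hst := DFunLike.congr_fun (congrFun hh ![s, t]) v
  have translate_eq_zero : Finsupp.mapDomain (s * ·) (h ![t]) v = 0 :=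
    Finsupp.mapDomain_of_notMem_range _ _ fun ⟨x, hx⟩ => hv x hx
  simp only [d_one_apply, leftRegular_apply, weightCochain, Matrix.cons_val_zero,
    Matrix.cons_val_one, Finsupp.add_apply, Finsupp.sub_apply, translate_eq_zero] at hst
  rw [← hst]
  abel

theorem eq_of_d_one_eq_weightCochain {φ : S → M} {h : (Fin 1 → S) → (S →₀ M)}
    (hh : d (leftRegular S M) 1 h = weightCochain φ) {u v : S} (huv : u ≠ v)
    (hu : ∀ x, u * x ≠ v) (hv : ∀ x, v * x ≠ v) (hvu : ∀ t, ∃ y, u * y = v * t) (t t' : S) :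
    φ t = φ t' := by
  have weight_eq (t : S) : φ t = h ![v] v - h ![u] v := by
    obtain ⟨y, hy⟩ := hvu t
    have at_u := apply_mul_of_d_one_eq_weightCochain hh hu y
    have at_v := apply_mul_of_d_one_eq_weightCochain hh hv t
    rw [Finsupp.single_eq_of_ne huv.symm, sub_zero, hy] at at_u
    rw [Finsupp.single_eq_same, at_u] at at_v
    rw [at_v, sub_sub_cancel]
  rw [weight_eq t, weight_eq t']

end WeightCochain

end EMCohomology

theorem mul_eq_right_of_mul_eq_left {T : Type*} [Semigroup T] [IsLeftCancelMul T] {s x : T}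
    (h : s * x = s) (y : T) : x * y = y :=
  mul_left_cancel (a := s) (by rw [← mul_assoc, h])

open EMCohomology in
theorem nontrivial_H_two_of_isTwoSidedSemigroupIdeal {T : Type*} [Semigroup T] [IsLeftCancelMul T]
    {M : Type*} [AddCommGroup M] {φ : T → M} (hφ : ∀ s t, φ (s * t) = φ s) {b c : T}
    (hbc : φ b ≠ φ c) {I : Subsemigroup T} (hI : IsTwoSidedSemigroupIdeal I) (hproper : I ≠ ⊤) :
    Nontrivial (H (leftRegular I M) 2) := by
  obtain ⟨s, hs⟩ := hI.nonempty
  obtain ⟨a, ha⟩ : ∃ a, a ∉ I := by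
    contrapose! hproper
    exact (Subsemigroup.eq_top_iff' I).2 hproper
  refine nontrivial_H_succ (f := weightCochain fun t : I => φ t) (d_weightCochain fun s t => hφ s t)
    fun h hh => hbc ?_
  let u : I := ⟨s, hs⟩
  let v : I := ⟨s * a, hI.mul_mem_right a s hs⟩
  have u_ne_v : u ≠ v := fun huv => by
    have a_mul : ∀ y, a * y = y := mul_eq_right_of_mul_eq_left (congrArg Subtype.val huv).symm
    exact hbc (by rw [← a_mul b, ← a_mul c, hφ, hφ])
  have u_mul_ne_v (x : I) : u * x ≠ v := fun hx =>
    ha (mul_left_cancel (congrArg Subtype.val hx) ▸ x.2)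
  have v_mul_ne_v (x : I) : v * x ≠ v := fun hx =>
    ha (mul_eq_right_of_mul_eq_left (congrArg Subtype.val hx) a ▸ hI.mul_mem_right a x x.2)
  have exists_mul_eq (t : I) : ∃ y, u * y = v * t :=
    ⟨⟨a * t, hI.mul_mem_left a t t.2⟩, Subtype.ext (mul_assoc s a t).symm⟩
  calc φ b = φ (b * s) := (hφ b s).symm
    _ = φ (c * s) := eq_of_d_one_eq_weightCochain hh u_ne_v u_mul_ne_v v_mul_ne_v exists_mul_eq
      ⟨b * s, hI.mul_mem_left b s hs⟩ ⟨c * s, hI.mul_mem_left c s hs⟩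
    _ = φ c := hφ c s

instance instIsLeftCancelMulFreeSemigroup {α : Type*} : IsLeftCancelMul (FreeSemigroup α) where
  mul_left_cancel := by
    rintro s ⟨x, xs⟩ ⟨y, ys⟩ h
    simpa using congrArg FreeSemigroup.tail h

theorem corollary5_general {T : Type u} [Semigroup T] [IsLeftCancelMul T] {P : Set T}
    (hP : ∀ s t, s * t ∈ P ↔ s ∈ P) (hne : P.Nonempty) (hne' : Pᶜ.Nonempty)
    (I : Subsemigroup T) (hI : IsTwoSidedSemigroupIdeal I) (hproper : I ≠ ⊤) :
    1 < EMCohomology.cohomologicalDimension I := by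
  classical
  obtain ⟨b, hb⟩ := hne
  obtain ⟨c, hc⟩ := hne'
  let φ : T → ℤ := P.indicator 1
  have hφ (s t : T) : φ (s * t) = φ s := by simp only [φ, Set.indicator_apply, hP, Pi.one_apply]
  have hbc : φ b ≠ φ c := by simp [φ, hb, Set.indicator_of_notMem hc]
  have hnontrivial := nontrivial_H_two_of_isTwoSidedSemigroupIdeal hφ hbc hI hproper
  exact lt_of_lt_of_le (by norm_num) (EMCohomology.le_cohomologicalDimension hnontrivial)

theorem corollary5 {α : Type u} [Nontrivial α] (I : Subsemigroup (FreeSemigroup α))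
    (hI : IsTwoSidedSemigroupIdeal I) (hproper : I ≠ ⊤) :
    1 < EMCohomology.cohomologicalDimension I := by
  obtain ⟨b, c, hbc⟩ := exists_pair_ne α
  exact corollary5_general (P := {w | w.head = b}) (by simp) ⟨.of b, rfl⟩ ⟨.of c, hbc.symm⟩
    I hI hproper
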